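/- Let $\gamma$ be Euler's constant, $\zeta$ the Riemann zeta function (analytically continued), and $G$ the Barnes $G$-function, defined for $t\in\mathbb{C}$ by the convergent product $$G(1+t) = (2\pi)^{t/2} \exp\left[-\tfrac12(\gamma t^2 + t^2 + t)\right] \prod_{k=1}^{\infty} \left\{ \left(1 + \frac{t}{k}\right)^k \exp\left(\frac{t^2}{2k} - t\right) \right\}.$$ Then $$\frac{1}{2\pi^2}\,\zeta'(2) = \frac{1}{12}\bigl(\log(2\pi)+\gamma-1\bigr)+\zeta'(-1),$$ the numbers $G(3/2)$ and $G(1/2)$ are real and positive, and $$\log G(3/2) = \frac{1}{24}\log 2+\frac14\log\pi+\frac32\,\zeta'(-1),\qquad \log G(1/2) = \frac{1}{24}\log 2-\frac14\log\pi+\frac32\,\zeta'(-1).$$ -/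

import Mathlib

/-- The factor of index `k + 1` of the product defining the Barnes function `G (1 + t)`:
`(1 + t / n) ^ n * exp (t ^ 2 / (2 * n) - t)` with `n = k + 1`. -/
noncomputable def barnesFactor (t : ℂ) (k : ℕ) : ℂ :=
  (1 + t / ((k : ℂ) + 1)) ^ (k + 1) * Complex.exp (t ^ 2 / (2 * ((k : ℂ) + 1)) - t)

/-- The Barnes `G`-function on `ℂ`, given by its Weierstrass product:
`G (1 + t) = (2 π) ^ (t / 2) * exp (-(γ t ^ 2 + t ^ 2 + t) / 2) *
  ∏_{n ≥ 1} (1 + t / n) ^ n * exp (t ^ 2 / (2 n) - t)`, with `t = z - 1`. -/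
noncomputable def barnesG (z : ℂ) : ℂ :=
  (2 * (Real.pi : ℂ)) ^ ((z - 1) / 2)
    * Complex.exp (-(1 / 2) *
        ((Real.eulerMascheroniConstant : ℂ) * (z - 1) ^ 2 + (z - 1) ^ 2 + (z - 1)))
    * ∏' k : ℕ, barnesFactor (z - 1) k

/-- The product in the definition of `barnesG` converges absolutely for every `t`. -/
theorem multipliable_barnesFactor (t : ℂ) : Multipliable (barnesFactor t) := by
  have key : Summable fun k : ℕ => barnesFactor t k - 1 := by
    have hs : Summable fun k : ℕ => (2 * ‖t‖ ^ 3) * (1 / ((k + 1 : ℕ) : ℝ) ^ 2) :=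
      ((summable_nat_add_iff 1).2
        (Real.summable_one_div_nat_pow.2 (by norm_num : 1 < 2))).mul_left _
    refine Summable.of_norm_bounded_eventually_nat hs ?_
    obtain ⟨N, hN⟩ := exists_nat_ge (2 * ‖t‖ + 2 * ‖t‖ ^ 3)
    filter_upwards [Filter.eventually_ge_atTop N] with k hk
    have hkN : (N : ℝ) ≤ k := by exact_mod_cast hk
    set n : ℝ := (k : ℝ) + 1 with hn
    have hn1 : 1 ≤ n := by have : (0 : ℝ) ≤ k := k.cast_nonneg
                           linarith
    have hn0 : 0 < n := by linarith
    have hnc : ((k : ℂ) + 1) = (n : ℂ) := by simp [hn]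
    have hnc0 : (n : ℂ) ≠ 0 := by exact_mod_cast hn0.ne'
    have ht0 : 0 ≤ ‖t‖ := norm_nonneg t
    have ht3 : 0 ≤ ‖t‖ ^ 3 := by positivity
    set u : ℂ := t / (n : ℂ) with hu
    have hun : ‖u‖ = ‖t‖ / n := by
      rw [hu, norm_div, Complex.norm_real, Real.norm_of_nonneg hn0.le]
    have hu2 : ‖u‖ ≤ 1 / 2 := by
      rw [hun, div_le_iff₀ hn0]; linarith
    have hlog := Complex.norm_log_sub_logTaylor_le 2 (z := u) (by linarith)
    have hT : Complex.logTaylor (2 + 1) u = u - u ^ 2 / 2 := by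
      simp [Complex.logTaylor, Finset.sum_range_succ]; ring
    rw [hT] at hlog
    have h1u : (1 : ℂ) + u ≠ 0 := by
      intro h
      have : u = -1 := by linear_combination h
      rw [this] at hu2
      norm_num at hu2
    set g : ℂ := (n : ℂ) * (Complex.log (1 + u) - (u - u ^ 2 / 2)) with hg
    have hfac : barnesFactor t k = Complex.exp g := by
      have e1 : (1 + u) ^ (k + 1) = Complex.exp ((n : ℂ) * Complex.log (1 + u)) := by
        have := Complex.exp_nat_mul (Complex.log (1 + u)) (k + 1)
        rw [Complex.exp_log h1u] at this
        rw [← this]; push_cast; rw [hnc]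
      rw [barnesFactor, hnc, ← hu, e1, ← Complex.exp_add]
      congr 1
      rw [hg, hu]; field_simp; ring
    have hinv : (1 - ‖u‖)⁻¹ ≤ 2 := by
      rw [inv_le_comm₀ (by linarith) (by norm_num)]; linarith
    have hgn : ‖g‖ ≤ ‖t‖ ^ 3 * (1 / n ^ 2) := by
      rw [hg, norm_mul, Complex.norm_real, Real.norm_of_nonneg hn0.le]
      calc n * ‖Complex.log (1 + u) - (u - u ^ 2 / 2)‖
          ≤ n * (‖u‖ ^ 3 * 2 / 2) := by
            refine mul_le_mul_of_nonneg_left (hlog.trans ?_) hn0.le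
            norm_num
            have : 0 ≤ ‖u‖ ^ 3 := by positivity
            nlinarith
        _ = ‖t‖ ^ 3 * (1 / n ^ 2) := by rw [hun]; field_simp
    have hg1 : ‖g‖ ≤ 1 := by
      refine hgn.trans ?_
      rw [mul_one_div, div_le_one (by positivity)]
      nlinarith
    rw [hfac]
    have := Complex.norm_exp_sub_one_le hg1
    push_cast
    rw [← hn]
    linarith
  have := Complex.multipliable_one_add_of_summable key
  simpa using this

/-! The relation between `ζ'(2)` and `ζ'(-1)` is the logarithmic derivative of the functional
equation at `s = 2`.

The Barnes values come from zeta regularisation. At `t = ε / 2` with `ε = ±1`, the logarithm of the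
`n`-th factor is, up to sign, the derivative at `w = 0` of `n ((2n + ε)^(-w) - (2n)^(-w))` plus
correction terms that make the sum over `n` converge near `w = 0` (`norm_regularizedTerm_le`). For
`re w > 2` the pieces sum separately, and since `2n + ε` is odd each is a multiple of `ζ(w - 1)`,
`ζ(w)` or `ζ(w + 1)` (`hasSum_regularizedTerm_of_two_lt_re`). The identity continues to `w = 0`
(`tsum_regularizedTerm_eventuallyEq`); differentiating there gives the logarithm of the product. The
terms in `γ` and the rational constants then cancel against the exponential prefactor of `G`. -/

/-! ### The functional equation differentiated at 2. -/

theorem deriv_riemannZeta_two_relation :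
    1 / (2 * (Real.pi : ℂ) ^ 2) * deriv riemannZeta 2
      = 1 / 12 * ((Real.log (2 * Real.pi) : ℂ) + (Real.eulerMascheroniConstant : ℂ) - 1)
        + deriv riemannZeta (-1) := by
  have hpi : (Real.pi : ℂ) ≠ 0 := by exact_mod_cast Real.pi_ne_zero
  have hev : (fun s : ℂ => riemannZeta (1 - s)) =ᶠ[nhds 2] fun s =>
      2 * (2 * (Real.pi : ℂ)) ^ (-s) * Complex.Gamma s * Complex.cos (Real.pi * s / 2)
        * riemannZeta s := by
    have h1 : ∀ᶠ s : ℂ in nhds 2, 1 < s.re :=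
      (isOpen_lt continuous_const Complex.continuous_re).mem_nhds (by simp)
    filter_upwards [h1] with s hs
    refine riemannZeta_one_sub (fun n h => ?_) (fun h => ?_)
    · rw [h] at hs
      simp only [Complex.neg_re, Complex.natCast_re] at hs
      linarith [(n.cast_nonneg : (0 : ℝ) ≤ n)]
    · simp [h] at hs
  have hl : HasDerivAt (fun s : ℂ => riemannZeta (1 - s)) (deriv riemannZeta (-1) * (-1)) 2 := by
    have h1 : HasDerivAt riemannZeta (deriv riemannZeta (-1)) (1 - (2 : ℂ)) := by
      have : (1 - (2 : ℂ)) = -1 := by norm_num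
      rw [this]
      exact (differentiableAt_riemannZeta (by norm_num)).hasDerivAt
    exact h1.comp (2 : ℂ) ((hasDerivAt_id (2 : ℂ)).const_sub 1)
  have hz : HasDerivAt riemannZeta (deriv riemannZeta 2) 2 :=
    (differentiableAt_riemannZeta (by norm_num)).hasDerivAt
  have hG : HasDerivAt Complex.Gamma (1 - (Real.eulerMascheroniConstant : ℂ)) 2 := by
    have h := Complex.hasDerivAt_Gamma_nat 1
    norm_num [harmonic] at h
    convert h using 1
    ring
  have hG2 : Complex.Gamma 2 = 1 := by
    rw [← one_add_one_eq_two, Complex.Gamma_add_one _ one_ne_zero, Complex.Gamma_one, one_mul]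
  -- The derivative is a multiple of `sin π = 0`, so the cosine contributes only its value `-1`.
  have hc : HasDerivAt (fun s : ℂ => Complex.cos (Real.pi * s / 2)) 0 2 := by
    have h := (((hasDerivAt_id (2 : ℂ)).const_mul (Real.pi : ℂ)).div_const 2).ccos
    convert! h using 1
    simp
  have hp : HasDerivAt (fun s : ℂ => (2 * (Real.pi : ℂ)) ^ (-s))
      ((2 * (Real.pi : ℂ)) ^ (-2 : ℂ) * Complex.log (2 * Real.pi) * (-1)) 2 :=
    (hasDerivAt_id (2 : ℂ)).neg.const_cpow (Or.inl (by simp [hpi]))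
  have hr := (((hp.const_mul 2).mul hG).mul hc).mul hz
  have hu := hl.unique (hr.congr_of_eventuallyEq hev)
  have hp2 : (2 * (Real.pi : ℂ)) ^ (-2 : ℂ) = 1 / (4 * (Real.pi : ℂ) ^ 2) := by
    rw [Complex.cpow_neg, show (2 : ℂ) = ((2 : ℕ) : ℂ) by norm_num, Complex.cpow_natCast]
    push_cast
    rw [mul_pow]
    norm_num
  have hlog : Complex.log (2 * Real.pi) = (Real.log (2 * Real.pi) : ℂ) := by
    rw [Complex.ofReal_log (by positivity)]
    push_cast
    rfl
  have hcos : Complex.cos (Real.pi * 2 / 2) = -1 := by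
    rw [mul_div_assoc]; norm_num
  simp only [Pi.mul_apply, hp2, hlog, hG2, hcos, riemannZeta_two] at hu
  field_simp at hu ⊢
  linear_combination hu

/-! ### Convergence of the regularised series near 0. -/

/-- Third-order Taylor bound for `(1 + u) ^ (-w) = exp (-w log (1 + u))` at `u = 0`,
uniform for `w` in a disc. -/
theorem norm_exp_neg_mul_log_sub_taylor_le {M : ℝ} {w u : ℂ} (hw : ‖w‖ ≤ M)
    (hu : ‖u‖ ≤ 1 / 2) :
    ‖Complex.exp (-w * Complex.log (1 + u)) - 1 + w * u - w * (w + 1) / 2 * u ^ 2‖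
      ≤ ((3 / 2 * M) ^ 3 * Real.exp M + M + 3 * M ^ 2) * ‖u‖ ^ 3 := by
  set L := Complex.log (1 + u) with hL
  have hM : 0 ≤ M := (norm_nonneg w).trans hw
  have hinv : (1 - ‖u‖)⁻¹ ≤ 2 := by
    rw [inv_le_comm₀ (by linarith) (by norm_num)]; linarith
  have hinv0 : 0 ≤ (1 - ‖u‖)⁻¹ := inv_nonneg.2 (by linarith)
  have h0 : ‖L‖ ≤ 3 / 2 * ‖u‖ := Complex.norm_log_one_add_half_le_self hu
  have h1 : ‖L - u‖ ≤ ‖u‖ ^ 2 := by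
    refine (Complex.norm_log_one_add_sub_self_le (by linarith)).trans ?_
    nlinarith [sq_nonneg ‖u‖]
  have h2 : ‖L - u + u ^ 2 / 2‖ ≤ ‖u‖ ^ 3 := by
    have h := Complex.norm_log_sub_logTaylor_le 2 (z := u) (by linarith)
    have hT : Complex.logTaylor (2 + 1) u = u - u ^ 2 / 2 := by
      simp [Complex.logTaylor, Finset.sum_range_succ]; ring
    rw [hT, ← sub_add] at h
    refine h.trans ?_
    norm_num
    have : 0 ≤ ‖u‖ ^ 3 := by positivity
    nlinarith
  have h3 : ‖-w * L‖ ≤ 3 / 2 * M * ‖u‖ := by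
    rw [norm_mul, norm_neg]
    calc ‖w‖ * ‖L‖ ≤ M * (3 / 2 * ‖u‖) := by gcongr
      _ = _ := by ring
  have h4 : ‖-w * L‖ ≤ M := h3.trans (by nlinarith)
  have h5 : ‖Complex.exp (-w * L) - (1 + -w * L + (-w * L) ^ 2 / 2)‖
      ≤ (3 / 2 * M) ^ 3 * Real.exp M * ‖u‖ ^ 3 := by
    have h := Complex.norm_exp_sub_sum_le_norm_mul_exp (-w * L) 3
    simp only [Finset.sum_range_succ, Finset.sum_range_zero] at h
    norm_num at h
    norm_num
    refine h.trans ?_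
    rw [norm_mul, norm_neg] at h3 h4
    calc (‖w‖ * ‖L‖) ^ 3 * Real.exp (‖w‖ * ‖L‖)
        ≤ (3 / 2 * M * ‖u‖) ^ 3 * Real.exp M := by gcongr
      _ = _ := by ring
  have h6 : ‖w * (L - u + u ^ 2 / 2)‖ ≤ M * ‖u‖ ^ 3 := by
    rw [norm_mul]; gcongr
  have h7 : ‖w ^ 2 / 2 * ((L - u) * (L + u))‖ ≤ 3 * M ^ 2 * ‖u‖ ^ 3 := by
    have h8 : ‖L + u‖ ≤ 5 / 2 * ‖u‖ := (norm_add_le _ _).trans (by linarith)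
    rw [norm_mul, norm_div, norm_pow, norm_mul]
    calc ‖w‖ ^ 2 / ‖(2 : ℂ)‖ * (‖L - u‖ * ‖L + u‖)
        ≤ M ^ 2 / ‖(2 : ℂ)‖ * (‖u‖ ^ 2 * (5 / 2 * ‖u‖)) := by gcongr
      _ = 5 / 4 * (M ^ 2 * ‖u‖ ^ 3) := by norm_num; ring
      _ ≤ 3 * M ^ 2 * ‖u‖ ^ 3 := by
        have : 0 ≤ M ^ 2 * ‖u‖ ^ 3 := by positivity
        linarith
  -- Three errors of order `u ^ 3`: the exponential cut at second order, `L` replaced by `u - u ^ 2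
  -- / 2` in the linear term, and `L ^ 2` replaced by `u ^ 2` in the quadratic one.
  have e : Complex.exp (-w * L) - 1 + w * u - w * (w + 1) / 2 * u ^ 2
      = (Complex.exp (-w * L) - (1 + -w * L + (-w * L) ^ 2 / 2)) - w * (L - u + u ^ 2 / 2)
        + w ^ 2 / 2 * ((L - u) * (L + u)) := by ring
  rw [e]
  refine (norm_add_le _ _).trans ?_
  have := norm_sub_le (Complex.exp (-w * L) - (1 + -w * L + (-w * L) ^ 2 / 2))
    (w * (L - u + u ^ 2 / 2))
  linarith

/-- The regularised summand `n * ((2 n + ε) ^ (-w) - (2 n) ^ (-w)) + ⋯` with `n = k + 1`: the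
second-order Taylor expansion in `ε` has been subtracted, so that the sum over `k` converges
for `-1 < re w`. -/
noncomputable def regularizedTerm (ε : ℝ) (k : ℕ) (w : ℂ) : ℂ :=
  ((k : ℂ) + 1) * (((2 * (k + 1) + ε : ℝ) : ℂ) ^ (-w) - ((2 * (k + 1) : ℝ) : ℂ) ^ (-w))
    + ε * w / 2 * ((2 * (k + 1) : ℝ) : ℂ) ^ (-w)
    - ε ^ 2 * w * (w + 1) / 4 * ((2 * (k + 1) : ℝ) : ℂ) ^ (-w - 1)

theorem differentiable_regularizedTerm {ε : ℝ} (hε : |ε| ≤ 1) (k : ℕ) :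
    Differentiable ℂ (regularizedTerm ε k) := by
  have hk : (0 : ℝ) ≤ k := k.cast_nonneg
  have hε' := (abs_le.1 hε).1
  have h1 : ((2 * (k + 1) + ε : ℝ) : ℂ) ≠ 0 := by
    exact_mod_cast (by linarith : (0 : ℝ) < 2 * (k + 1) + ε).ne'
  have h2 : ((2 * (k + 1) : ℝ) : ℂ) ≠ 0 := by
    exact_mod_cast (by linarith : (0 : ℝ) < 2 * (k + 1)).ne'
  have d1 : Differentiable ℂ fun w : ℂ => ((2 * (k + 1) + ε : ℝ) : ℂ) ^ (-w) :=
    differentiable_id.neg.const_cpow (Or.inl h1)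
  have d2 : Differentiable ℂ fun w : ℂ => ((2 * (k + 1) : ℝ) : ℂ) ^ (-w) :=
    differentiable_id.neg.const_cpow (Or.inl h2)
  have d3 : Differentiable ℂ fun w : ℂ => ((2 * (k + 1) : ℝ) : ℂ) ^ (-w - 1) :=
    (differentiable_id.neg.sub_const 1).const_cpow (Or.inl h2)
  unfold regularizedTerm
  fun_prop

/-- Factoring out `n (2n)^(-w)` leaves a Taylor remainder in `v = ε / (2n)` of size `n ^ (-3)`. For
`re w ≥ -1/2` the prefactor is at most of order `n ^ (3/2)`, so the term is `O(n ^ (-3/2))`,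
uniformly on bounded sets. -/
theorem norm_regularizedTerm_le {ε M : ℝ} (hε : |ε| ≤ 1) (k : ℕ) {w : ℂ} (hw : ‖w‖ ≤ M)
    (hre : -(1 / 2) ≤ w.re) :
    ‖regularizedTerm ε k w‖ ≤ ((3 / 2 * M) ^ 3 * Real.exp M + M + 3 * M ^ 2)
      * (1 / ((k + 1 : ℕ) : ℝ) ^ (3 / 2 : ℝ)) := by
  set n : ℝ := (k : ℝ) + 1 with hn
  have hM : 0 ≤ M := (norm_nonneg w).trans hw
  have hn1 : 1 ≤ n := by
    have : (0 : ℝ) ≤ k := k.cast_nonneg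
    linarith
  have hn0 : 0 < n := by linarith
  have hε' := abs_le.1 hε
  have hnc : ((k : ℂ) + 1) = (n : ℂ) := by simp [hn]
  have hnc0 : (n : ℂ) ≠ 0 := by exact_mod_cast hn0.ne'
  set v : ℝ := ε / (2 * n) with hv
  have hvabs : |v| ≤ 1 / (2 * n) := by
    rw [hv, abs_div, abs_of_pos (by linarith : (0 : ℝ) < 2 * n)]
    gcongr
  have hv2 : |v| ≤ 1 / 2 := hvabs.trans (by
    rw [div_le_div_iff₀ (by linarith) (by norm_num)]; linarith)
  have hv1 : 0 < 1 + v := by linarith [(abs_le.1 hv2).1]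
  have hsplit : ((2 * n + ε : ℝ) : ℂ) ^ (-w)
      = ((2 * n : ℝ) : ℂ) ^ (-w) * Complex.exp (-w * Complex.log (1 + (v : ℂ))) := by
    have e : 2 * n + ε = (2 * n) * (1 + v) := by rw [hv]; field_simp
    have h1v : (1 + (v : ℂ)) ≠ 0 := by exact_mod_cast hv1.ne'
    rw [e, Complex.ofReal_mul, Complex.mul_cpow_ofReal_nonneg (by linarith) hv1.le]
    congr 1
    push_cast
    rw [Complex.cpow_def_of_ne_zero h1v, mul_comm]
  have hsub : ((2 * n : ℝ) : ℂ) ^ (-w - 1) = ((2 * n : ℝ) : ℂ) ^ (-w) / (2 * n) := by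
    rw [Complex.cpow_sub _ _ (by exact_mod_cast (by linarith : (0 : ℝ) < 2 * n).ne'),
      Complex.cpow_one]
    push_cast
    rfl
  have hterm : regularizedTerm ε k w = ((2 * n : ℝ) : ℂ) ^ (-w) * n *
      (Complex.exp (-w * Complex.log (1 + (v : ℂ))) - 1 + w * v - w * (w + 1) / 2 * (v : ℂ) ^ 2) := by
    rw [regularizedTerm, ← hn, hnc, hsplit, hsub, hv]
    push_cast
    field_simp
    ring
  have hT := norm_exp_neg_mul_log_sub_taylor_le (u := (v : ℂ)) hw
    (by rw [Complex.norm_real]; exact hv2)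
  rw [Complex.norm_real, Real.norm_eq_abs] at hT
  set C := (3 / 2 * M) ^ 3 * Real.exp M + M + 3 * M ^ 2 with hC
  have hC0 : 0 ≤ C := by positivity
  have hpow : ‖((2 * n : ℝ) : ℂ) ^ (-w)‖ ≤ (2 * n) ^ (1 / 2 : ℝ) := by
    rw [Complex.norm_cpow_eq_rpow_re_of_pos (by linarith)]
    refine Real.rpow_le_rpow_of_exponent_le (by linarith) ?_
    rw [Complex.neg_re]; linarith
  rw [hterm, norm_mul, norm_mul, Complex.norm_real, Real.norm_of_nonneg hn0.le]
  have h2half : (2 : ℝ) ^ (1 / 2 : ℝ) ≤ 2 := by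
    calc (2 : ℝ) ^ (1 / 2 : ℝ) ≤ 2 ^ (1 : ℝ) :=
          Real.rpow_le_rpow_of_exponent_le (by norm_num) (by norm_num)
      _ = 2 := Real.rpow_one 2
  have hn32 : n ^ (1 / 2 : ℝ) / n ^ 2 = 1 / n ^ (3 / 2 : ℝ) := by
    rw [← Real.rpow_natCast n 2, ← Real.rpow_sub hn0, one_div (n ^ _), ← Real.rpow_neg hn0.le]
    norm_num
  calc _ ≤ (2 * n) ^ (1 / 2 : ℝ) * n * (C * (1 / (2 * n)) ^ 3) := by
        refine mul_le_mul (by gcongr) (hT.trans ?_) (norm_nonneg _) (by positivity)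
        gcongr
    _ = (2 : ℝ) ^ (1 / 2 : ℝ) / 8 * (C * (n ^ (1 / 2 : ℝ) / n ^ 2)) := by
        rw [Real.mul_rpow (by norm_num) hn0.le]
        field_simp
        ring
    _ ≤ 1 * (C * (n ^ (1 / 2 : ℝ) / n ^ 2)) := by gcongr; linarith
    _ = _ := by rw [one_mul, hn32]; push_cast; rfl

/-! ### Dirichlet series in the half-plane of convergence. -/

theorem hasSum_nat_add_one_cpow_neg {w : ℂ} (hw : 1 < w.re) :
    HasSum (fun k : ℕ => ((k : ℂ) + 1) ^ (-w)) (riemannZeta w) := by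
  have hs : Summable fun k : ℕ => 1 / ((k : ℂ) + 1) ^ w := by
    have h := (summable_nat_add_iff 1).2 (Complex.summable_one_div_nat_cpow.2 hw)
    simpa using h
  rw [zeta_eq_tsum_one_div_nat_add_one_cpow hw]
  simpa [Complex.cpow_neg] using hs.hasSum

theorem hasSum_two_mul_nat_add_one_cpow_neg {w : ℂ} (hw : 1 < w.re) :
    HasSum (fun k : ℕ => (2 * ((k : ℂ) + 1)) ^ (-w)) (2 ^ (-w) * riemannZeta w) := by
  refine ((hasSum_nat_add_one_cpow_neg hw).mul_left (2 ^ (-w))).congr_fun ?_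
  intro k
  have := Complex.natCast_mul_natCast_cpow 2 (k + 1) (-w)
  push_cast at this
  exact this

theorem hasSum_odd_cpow_neg {w : ℂ} (hw : 1 < w.re) :
    HasSum (fun k : ℕ => (2 * (k : ℂ) + 1) ^ (-w)) ((1 - 2 ^ (-w)) * riemannZeta w) := by
  have h := hasSum_nat_add_one_cpow_neg hw
  have hodd : Summable fun k : ℕ => (2 * (k : ℂ) + 1) ^ (-w) := by
    have := h.summable.comp_injective (i := fun k : ℕ => 2 * k)
      (fun a b hab => by simpa using hab)
    simpa [Function.comp_def] using this
  have heven := hasSum_two_mul_nat_add_one_cpow_neg hw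
  have hsum : HasSum (fun k : ℕ => ((k : ℂ) + 1) ^ (-w))
      ((∑' k : ℕ, (2 * (k : ℂ) + 1) ^ (-w)) + 2 ^ (-w) * riemannZeta w) := by
    refine HasSum.even_add_odd ?_ ?_
    · simpa using hodd.hasSum
    · convert heven using 2 with k
      push_cast
      ring_nf
  have := h.unique hsum
  convert hodd.hasSum using 1
  linear_combination this

/-- Write `k = ((2k + 1) - 1) / 2` and use the odd series at `w - 1` and at `w`. -/
theorem hasSum_mul_odd_cpow_neg {w : ℂ} (hw : 2 < w.re) :
    HasSum (fun k : ℕ => (k : ℂ) * (2 * (k : ℂ) + 1) ^ (-w))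
      (1 / 2 * ((1 - 2 ^ (1 - w)) * riemannZeta (w - 1) - (1 - 2 ^ (-w)) * riemannZeta w)) := by
  have h1 := hasSum_odd_cpow_neg (w := w - 1) (by simp; linarith)
  have h2 := hasSum_odd_cpow_neg (w := w) (by linarith)
  rw [neg_sub] at h1
  refine ((h1.sub h2).mul_left (1 / 2)).congr_fun fun k => ?_
  have hk : (2 * (k : ℂ) + 1) ≠ 0 := by exact_mod_cast (2 * k).succ_ne_zero
  rw [sub_eq_add_neg 1 w, Complex.cpow_add _ _ hk, Complex.cpow_one]
  ring

/-- The sum of the regularised terms, expressed through `ζ`. -/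
noncomputable def regularizedSum (ε w : ℂ) : ℂ :=
  1 / 2 * ((1 - 2 ^ (1 - w)) * riemannZeta (w - 1) - ε * ((1 - 2 ^ (-w)) * riemannZeta w))
    - 2 ^ (-w) * riemannZeta (w - 1) + ε * w / 2 * (2 ^ (-w) * riemannZeta w)
    - (w + 1) / 8 * (2 ^ (-w) * riemannZeta₁ (w + 1))

theorem hasSum_regularizedTerm_of_two_lt_re {ε : ℝ} (hε : ε = 1 ∨ ε = -1) {w : ℂ}
    (hw : 2 < w.re) :
    HasSum (fun k => regularizedTerm ε k w) (regularizedSum ε w) := by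
  have hw0 : w ≠ 0 := by
    rintro rfl
    norm_num at hw
  have h1 : HasSum (fun k : ℕ => ((k : ℂ) + 1) * ((2 * (k + 1) + ε : ℝ) : ℂ) ^ (-w))
      (1 / 2 * ((1 - 2 ^ (1 - w)) * riemannZeta (w - 1)
        - ε * ((1 - 2 ^ (-w)) * riemannZeta w))) := by
    have h := hasSum_mul_odd_cpow_neg hw
    rcases hε with rfl | rfl
    -- For `ε = 1` the series is the previous one shifted by one index, the dropped term being zero.
    -- For `ε = -1` the weight is `k + 1` instead of `k`, which adds one odd series.
    · have h' := (hasSum_nat_add_iff' 1).2 h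
      simp only [Finset.sum_range_one, Nat.cast_zero, zero_mul, sub_zero] at h'
      simpa using h'
    · have h' := h.add (hasSum_odd_cpow_neg (w := w) (by linarith))
      convert! h' using 1
      · funext k
        have : ((2 * (k + 1) + -1 : ℝ) : ℂ) = 2 * (k : ℂ) + 1 := by push_cast; ring
        rw [this]; ring
      · push_cast; ring
  have h2 : HasSum (fun k : ℕ => ((k : ℂ) + 1) * ((2 * (k + 1) : ℝ) : ℂ) ^ (-w))
      (2 ^ (-w) * riemannZeta (w - 1)) := by
    have h := (hasSum_two_mul_nat_add_one_cpow_neg (w := w - 1) (by simp; linarith)).mul_left (1 / 2)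
    have e : ∀ z : ℂ, z ≠ 0 → z ^ (-(w - 1)) = z * z ^ (-w) := fun z hz => by
      rw [neg_sub, sub_eq_add_neg 1 w, Complex.cpow_add _ _ hz, Complex.cpow_one]
    convert! h using 1
    · funext k
      have hk : (2 * ((k : ℂ) + 1)) ≠ 0 := by
        exact_mod_cast (by positivity : 2 * (k + 1) ≠ 0)
      rw [e _ hk]
      push_cast
      ring
    · rw [e 2 two_ne_zero]; ring
  have h3 := (hasSum_two_mul_nat_add_one_cpow_neg (w := w) (by linarith)).mul_left (ε * w / 2 : ℂ)
  have h4 := (hasSum_two_mul_nat_add_one_cpow_neg (w := w + 1) (by simp; linarith)).mul_left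
    (ε ^ 2 * w * (w + 1) / 4 : ℂ)
  -- The factor `w` of the quadratic correction cancels the pole of `ζ(w + 1)` at `w = 0`, leaving
  -- the entire function `riemannZeta₁`.
  have hz : riemannZeta (w + 1) = w⁻¹ * riemannZeta₁ (w + 1) := by
    simpa using riemannZeta_eq_inv_sub_mul (s := w + 1) (by simpa using hw0)
  have h := ((h1.sub h2).add h3).sub h4
  convert! h using 1
  · funext k
    rw [regularizedTerm]
    push_cast
    rw [show -(w + 1) = -w - 1 by ring]
    ring
  · have hε2 : (ε : ℂ) ^ 2 = 1 := by rcases hε with rfl | rfl <;> norm_num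
    have h2w : (2 : ℂ) ^ (-w - 1) = 2 ^ (-w) / 2 := by
      rw [Complex.cpow_sub _ _ two_ne_zero, Complex.cpow_one]
    rw [regularizedSum, hz, hε2, show -(w + 1) = -w - 1 by ring, h2w]
    linear_combination (w + 1) / 8 * 2 ^ (-w) * riemannZeta₁ (w + 1) * mul_inv_cancel₀ hw0

/-! ### The closed form at 0 and analytic continuation. -/

theorem riemannZeta_neg_one : riemannZeta (-1) = -1 / 12 := by
  have h := riemannZeta_neg_nat_eq_bernoulli 1
  norm_num [bernoulli_eq_bernoulli'_of_ne_one, bernoulli'_two] at h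
  rw [h]; norm_num

theorem differentiableAt_regularizedSum (ε : ℂ) {w : ℂ} (h1 : w ≠ 1) (h2 : w ≠ 2) :
    DifferentiableAt ℂ (regularizedSum ε) w := by
  have d1 : DifferentiableAt ℂ (fun w => riemannZeta (w - 1)) w :=
    DifferentiableAt.comp w
      (differentiableAt_riemannZeta fun h => h2 (by linear_combination h)) (by fun_prop)
  have d2 : DifferentiableAt ℂ riemannZeta w := differentiableAt_riemannZeta h1
  have d3 : DifferentiableAt ℂ (fun w : ℂ => (2 : ℂ) ^ (1 - w)) w :=
    (by fun_prop : DifferentiableAt ℂ (fun w : ℂ => 1 - w) w).const_cpow (Or.inl two_ne_zero)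
  have d4 : DifferentiableAt ℂ (fun w : ℂ => (2 : ℂ) ^ (-w)) w :=
    (by fun_prop : DifferentiableAt ℂ (fun w : ℂ => -w) w).const_cpow (Or.inl two_ne_zero)
  unfold regularizedSum
  fun_prop

/-- `ζ'(0)` drops out because its coefficients `1 - 2^(-w)` and `ε w / 2` vanish at `w = 0`. The
constant `γ` enters as the derivative of `riemannZeta₁` at 1. -/
theorem deriv_regularizedSum_zero (ε : ℂ) :
    deriv (regularizedSum ε) 0 = -(3 / 2) * deriv riemannZeta (-1)
      - 1 / 6 * Complex.log 2 + ε / 4 * (Complex.log 2 - 1)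
      - 1 / 8 * (1 - Complex.log 2 + Real.eulerMascheroniConstant) := by
  have z1 : HasDerivAt (fun w => riemannZeta (w - 1)) (deriv riemannZeta (-1)) 0 := by
    have h : HasDerivAt riemannZeta (deriv riemannZeta (-1)) (0 - 1) := by
      rw [zero_sub]
      exact (differentiableAt_riemannZeta (by norm_num)).hasDerivAt
    exact h.comp_sub_const 0 1
  have z0 : HasDerivAt riemannZeta (deriv riemannZeta 0) 0 :=
    (differentiableAt_riemannZeta (by norm_num)).hasDerivAt
  have z2 : HasDerivAt (fun w => riemannZeta₁ (w + 1)) (Real.eulerMascheroniConstant : ℂ) 0 := by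
    have h : HasDerivAt riemannZeta₁ (Real.eulerMascheroniConstant : ℂ) (0 + 1) := by
      rw [zero_add, ← deriv_riemannZeta₁_one]
      exact differentiable_riemannZeta₁.differentiableAt.hasDerivAt
    exact h.comp_add_const 0 1
  have p1 : HasDerivAt (fun w : ℂ => (2 : ℂ) ^ (1 - w)) (2 ^ (1 - (0 : ℂ)) * Complex.log 2 * (-1))
      0 := ((hasDerivAt_id (0 : ℂ)).const_sub 1).const_cpow (Or.inl two_ne_zero)
  have p0 : HasDerivAt (fun w : ℂ => (2 : ℂ) ^ (-w)) (2 ^ (-(0 : ℂ)) * Complex.log 2 * (-1)) 0 :=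
    (hasDerivAt_id (0 : ℂ)).neg.const_cpow (Or.inl two_ne_zero)
  have a := ((p1.const_sub 1).mul z1).sub (((p0.const_sub 1).mul z0).const_mul ε)
  have b := (a.const_mul (1 / 2)).sub (p0.mul z1)
  have c := b.add ((((hasDerivAt_id (0 : ℂ)).const_mul ε).div_const 2).mul (p0.mul z0))
  have d := c.sub ((((hasDerivAt_id (0 : ℂ)).add_const 1).div_const 8).mul (p0.mul z2))
  have e : HasDerivAt (regularizedSum ε) _ 0 := d
  rw [e.deriv]
  simp [riemannZeta_zero, riemannZeta_neg_one]
  ring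

theorem summable_const_mul_one_div_nat_add_one_rpow (C : ℝ) :
    Summable fun k : ℕ => C * (1 / ((k + 1 : ℕ) : ℝ) ^ (3 / 2 : ℝ)) :=
  ((summable_nat_add_iff 1).2
    (Real.summable_one_div_nat_rpow.2 (by norm_num : (1 : ℝ) < 3 / 2))).mul_left C

theorem tsum_regularizedTerm_eventuallyEq {ε : ℝ} (hε : ε = 1 ∨ ε = -1) :
    (fun w => ∑' k, regularizedTerm ε k w) =ᶠ[nhds 0] regularizedSum ε := by
  have hε1 : |ε| ≤ 1 := by rcases hε with rfl | rfl <;> simp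
  -- The last half-plane excludes 1 and 2, where `ζ(w)` and `ζ(w - 1)` have poles, but keeps 0 and
  -- `3 + 2i`. Thus `U` is convex and reaches the region `re w > 2` without meeting them.
  let U : Set ℂ := {w | -(1 / 2) < w.re} ∩ Metric.ball 0 5 ∩ {w | 1 / 4 * w.re - w.im < 1 / 8}
  have hlin : IsLinearMap ℝ fun w : ℂ => 1 / 4 * w.re - w.im :=
    ⟨fun x y => by simp; ring, fun c x => by simp; ring⟩
  have hUc : Convex ℝ U :=
    ((convex_halfSpace_re_gt _).inter (convex_ball _ _)).inter (convex_halfSpace_lt hlin _)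
  have hUo : IsOpen U := by
    refine ((isOpen_lt continuous_const Complex.continuous_re).inter Metric.isOpen_ball).inter ?_
    exact isOpen_lt (by fun_prop) continuous_const
  have h0 : (0 : ℂ) ∈ U := by simp [U]
  have h3 : (3 + 2 * Complex.I : ℂ) ∈ U := by
    refine ⟨⟨by norm_num, ?_⟩, by norm_num⟩
    rw [mem_ball_zero_iff, ← sq_lt_sq₀ (norm_nonneg _) (by norm_num), Complex.sq_norm,
      Complex.normSq_apply]
    norm_num
  have hf : DifferentiableOn ℂ (fun w => ∑' k, regularizedTerm ε k w) U :=
    Complex.differentiableOn_tsum_of_summable_norm (summable_const_mul_one_div_nat_add_one_rpow _)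
      (fun k => (differentiable_regularizedTerm hε1 k).differentiableOn) hUo
      (fun k w hw => norm_regularizedTerm_le hε1 k (mem_ball_zero_iff.1 hw.1.2).le hw.1.1.le)
  have hg : DifferentiableOn ℂ (regularizedSum ε) U := fun w hw => by
    refine (differentiableAt_regularizedSum _ ?_ ?_).differentiableWithinAt
    · rintro rfl
      have := hw.2
      norm_num at this
    · rintro rfl
      have := hw.2
      norm_num at this
  have hev : (fun w => ∑' k, regularizedTerm ε k w) =ᶠ[nhds (3 + 2 * Complex.I : ℂ)]
      regularizedSum ε := by
    have h : ∀ᶠ w : ℂ in nhds (3 + 2 * Complex.I : ℂ), 2 < w.re :=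
      (isOpen_lt continuous_const Complex.continuous_re).mem_nhds (by norm_num)
    filter_upwards [h] with w hw
    exact (hasSum_regularizedTerm_of_two_lt_re hε hw).tsum_eq
  exact ((hf.analyticOnNhd hUo).eqOn_of_preconnected_of_eventuallyEq (hg.analyticOnNhd hUo)
    hUc.isPreconnected h3 hev).eventuallyEq_of_mem (hUo.mem_nhds h0)

/-! ### From the regularised series back to the Barnes product. -/

/-- The logarithm of the factor of index `n = k + 1` of the product defining `G (1 + ε / 2)`. -/
noncomputable def logBarnesFactor (ε : ℝ) (k : ℕ) : ℝ :=
  (k + 1) * (Real.log (2 * (k + 1) + ε) - Real.log (2 * (k + 1))) - ε / 2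
    + ε ^ 2 / (8 * (k + 1))

theorem barnesFactor_eq_exp {ε : ℝ} (hε : |ε| ≤ 1) (k : ℕ) :
    barnesFactor (ε / 2) k = Complex.exp (logBarnesFactor ε k) := by
  have hk : (0 : ℝ) ≤ k := k.cast_nonneg
  have h1 : (0 : ℝ) < 2 * (k + 1) + ε := by linarith [(abs_le.1 hε).1]
  have h2 : (0 : ℝ) < 2 * (k + 1) := by linarith
  have h3 : (0 : ℝ) < k + 1 := by linarith
  rw [← Complex.ofReal_exp]
  have e : Real.exp (logBarnesFactor ε k)
      = (1 + ε / 2 / (k + 1)) ^ (k + 1) * Real.exp ((ε / 2) ^ 2 / (2 * (k + 1)) - ε / 2) := by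
    have e1 : (1 + ε / 2 / (k + 1)) ^ (k + 1)
        = Real.exp ((k + 1) * (Real.log (2 * (k + 1) + ε) - Real.log (2 * (k + 1)))) := by
      rw [← Real.log_div h1.ne' h2.ne']
      have := Real.exp_nat_mul (Real.log ((2 * (k + 1) + ε) / (2 * (k + 1)))) (k + 1)
      push_cast at this
      rw [this, Real.exp_log (div_pos h1 h2)]
      congr 1
      field_simp
    rw [e1, ← Real.exp_add, logBarnesFactor]
    congr 1
    field_simp
    ring
  rw [e, barnesFactor]
  push_cast
  rfl

theorem deriv_regularizedTerm_zero {ε : ℝ} (hε : |ε| ≤ 1) (k : ℕ) :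
    deriv (regularizedTerm ε k) 0 = -(logBarnesFactor ε k : ℂ) := by
  have hk : (0 : ℝ) ≤ k := k.cast_nonneg
  have h1 : (0 : ℝ) < 2 * (k + 1) + ε := by linarith [(abs_le.1 hε).1]
  have h2 : (0 : ℝ) < 2 * (k + 1) := by linarith
  have h1' : ((2 * (k + 1) + ε : ℝ) : ℂ) ≠ 0 := by exact_mod_cast h1.ne'
  have h2' : ((2 * (k + 1) : ℝ) : ℂ) ≠ 0 := by exact_mod_cast h2.ne'
  have hk' : ((k : ℂ) + 1) ≠ 0 := by exact_mod_cast k.succ_ne_zero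
  have hd := (hasDerivAt_id (0 : ℂ)).neg
  have p1 := hd.const_cpow (c := ((2 * (k + 1) + ε : ℝ) : ℂ)) (Or.inl h1')
  have p2 := hd.const_cpow (c := ((2 * (k + 1) : ℝ) : ℂ)) (Or.inl h2')
  have p3 := (hd.sub_const 1).const_cpow (c := ((2 * (k + 1) : ℝ) : ℂ)) (Or.inl h2')
  have a := ((p1.sub p2).const_mul ((k : ℂ) + 1)).add
    ((((hasDerivAt_id (0 : ℂ)).const_mul (ε : ℂ)).div_const 2).mul p2)
  have b := a.sub (((((hasDerivAt_id (0 : ℂ)).const_mul ((ε : ℂ) ^ 2)).mul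
    ((hasDerivAt_id (0 : ℂ)).add_const 1)).div_const 4).mul p3)
  have e : HasDerivAt (regularizedTerm ε k) _ 0 := b
  rw [e.deriv, ← Complex.ofReal_log h1.le, ← Complex.ofReal_log h2.le]
  simp [logBarnesFactor, Complex.cpow_neg_one]
  field_simp
  ring

/-- The uniform bound near 0 permits termwise differentiation, and the continued identity evaluates
the derivative of the sum. -/
theorem hasSum_logBarnesFactor {ε : ℝ} (hε : ε = 1 ∨ ε = -1) :
    HasSum (fun k => (logBarnesFactor ε k : ℂ)) (-deriv (regularizedSum ε) 0) := by
  have hε1 : |ε| ≤ 1 := by rcases hε with rfl | rfl <;> simp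
  let U : Set ℂ := {w | -(1 / 2) < w.re} ∩ Metric.ball 0 1
  have hUo : IsOpen U :=
    (isOpen_lt continuous_const Complex.continuous_re).inter Metric.isOpen_ball
  have h := Complex.hasSum_deriv_of_summable_norm (F := regularizedTerm ε) (z := 0)
    (summable_const_mul_one_div_nat_add_one_rpow _)
    (fun k => (differentiable_regularizedTerm hε1 k).differentiableOn) hUo
    (fun k w hw => norm_regularizedTerm_le hε1 k (mem_ball_zero_iff.1 hw.2).le hw.1.le)
    (by simp [U])
  rw [(tsum_regularizedTerm_eventuallyEq hε).deriv_eq] at h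
  simpa [deriv_regularizedTerm_zero hε1] using h.neg

theorem barnesG_one_add_half {ε : ℝ} (hε : ε = 1 ∨ ε = -1) :
    ∃ x : ℝ, barnesG (1 + ε / 2) = (Real.exp x : ℂ) ∧
      (x : ℂ) = 1 / 24 * (Real.log 2 : ℂ) + ε / 4 * (Real.log Real.pi : ℂ)
        + 3 / 2 * deriv riemannZeta (-1) := by
  have hε1 : |ε| ≤ 1 := by rcases hε with rfl | rfl <;> simp
  have hε2 : (ε : ℂ) ^ 2 = 1 := by rcases hε with rfl | rfl <;> norm_num
  have hsum := hasSum_logBarnesFactor hε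
  -- A real `S` exhibits the product as the exponential of a real number, so `G` is positive and its
  -- principal logarithm is the real exponent.
  obtain ⟨S, hSe⟩ : ∃ S : ℝ, (S : ℂ) = -deriv (regularizedSum ε) 0 :=
    ⟨∑' k, logBarnesFactor ε k, by rw [Complex.ofReal_tsum, hsum.tsum_eq]⟩
  have hprod : ∏' k, barnesFactor (ε / 2) k = Complex.exp (S : ℂ) := by
    rw [hSe, ← hsum.cexp.tprod_eq]
    exact tprod_congr fun k => barnesFactor_eq_exp hε1 k
  have hpi : (2 * (Real.pi : ℂ)) ≠ 0 := by
    exact_mod_cast (by positivity : 2 * Real.pi ≠ 0)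
  have hlog : Complex.log (2 * Real.pi) = (Real.log (2 * Real.pi) : ℂ) := by
    rw [Complex.ofReal_log (by positivity)]
    push_cast
    rfl
  have hlog2 : Complex.log 2 = (Real.log 2 : ℂ) := by
    rw [Complex.ofReal_log (by positivity)]
    norm_num
  refine ⟨ε / 4 * Real.log (2 * Real.pi)
    - 1 / 2 * (Real.eulerMascheroniConstant / 4 * ε ^ 2 + ε ^ 2 / 4 + ε / 2) + S, ?_, ?_⟩
  · rw [barnesG, add_sub_cancel_left, hprod, Complex.cpow_def_of_ne_zero hpi, hlog,
      ← Complex.exp_add, ← Complex.exp_add, Complex.ofReal_exp]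
    congr 1
    push_cast
    ring
  · rw [Real.log_mul (by norm_num) Real.pi_ne_zero]
    push_cast
    rw [hSe, deriv_regularizedSum_zero, hε2, hlog2]
    ring

theorem mainTheorem4 :
    -- the relation between the derivatives of zeta at 2 and at -1
    (1 / (2 * (Real.pi : ℂ) ^ 2) * deriv riemannZeta 2
        = 1 / 12 * ((Real.log (2 * Real.pi) : ℂ) + (Real.eulerMascheroniConstant : ℂ) - 1)
          + deriv riemannZeta (-1)) ∧
    -- the value at 3/2, a positive real number
    ((barnesG (3 / 2)).im = 0 ∧ 0 < (barnesG (3 / 2)).re ∧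
      Complex.log (barnesG (3 / 2))
        = 1 / 24 * (Real.log 2 : ℂ) + 1 / 4 * (Real.log Real.pi : ℂ)
          + 3 / 2 * deriv riemannZeta (-1)) ∧
    -- the value at 1/2, a positive real number
    ((barnesG (1 / 2)).im = 0 ∧ 0 < (barnesG (1 / 2)).re ∧
      Complex.log (barnesG (1 / 2))
        = 1 / 24 * (Real.log 2 : ℂ) - 1 / 4 * (Real.log Real.pi : ℂ)
          + 3 / 2 * deriv riemannZeta (-1)) := by
  refine ⟨deriv_riemannZeta_two_relation, ?_, ?_⟩
  · obtain ⟨x, hx, hx'⟩ := barnesG_one_add_half (ε := 1) (Or.inl rfl)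
    rw [show (1 + ((1 : ℝ) : ℂ) / 2) = 3 / 2 by norm_num] at hx
    rw [hx]
    refine ⟨Complex.ofReal_im _, by rw [Complex.ofReal_re]; exact Real.exp_pos x, ?_⟩
    rw [← Complex.ofReal_log (Real.exp_pos x).le, Real.log_exp, hx']
    push_cast
    ring
  · obtain ⟨x, hx, hx'⟩ := barnesG_one_add_half (ε := -1) (Or.inr rfl)
    rw [show (1 + ((-1 : ℝ) : ℂ) / 2) = 1 / 2 by norm_num] at hx
    rw [hx]
    refine ⟨Complex.ofReal_im _, by rw [Complex.ofReal_re]; exact Real.exp_pos x, ?_⟩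
    rw [← Complex.ofReal_log (Real.exp_pos x).le, Real.log_exp, hx']
    push_cast
    ring
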